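/- **Theorem 1.3 (GH-new).** For complex $a,q$ with $|q|<1$ put $(a;q)_0=1$, $(a;q)_n=\prod_{k=0}^{n-1}(1-aq^k)$ for $n\ge 1$, $(a;q)_\infty=\lim_{n\to\infty}(a;q)_n$, and let $$G(q)=\sum_{n=0}^\infty\frac{q^{n^2}}{(q;q)_n},\qquad H(q)=\sum_{n=0}^\infty\frac{q^{n(n+1)}}{(q;q)_n}$$ be the Rogers–Ramanujan functions. Then for every complex $q$ with $|q|<1$ we have $G(q)\neq 0$ and $H(q)\neq 0$ (so that, applying this also to powers of $q$, the quotients below are well defined), and $$\frac{G(q^2)G(q^3)}{H(q)G(q^6)}-\frac{H(q^2)H(q^3)}{G(q)H(q^6)}=q\,\frac{(q^5;q^5)_\infty^2(q^{30};q^{30})_\infty^2}{(q^{10};q^{10})_\infty^2(q^{15};q^{15})_\infty^2}$$ and $$\frac{H(q)G(q^6)}{H(q^2)H(q^3)}-q^2\,\frac{G(q)H(q^6)}{G(q^2)G(q^3)}=\frac{(q^{10};q^{10})_\infty^2(q^{15};q^{15})_\infty^2}{(q^5;q^5)_\infty^2(q^{30};q^{30})_\infty^2}.$$ -/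

import Mathlib

open Filter Topology

namespace RogersRamanujan

/-- The finite `q`-Pochhammer symbol `(a;q)_n = ∏_{k=0}^{n-1} (1 - a q^k)`, with `(a;q)_0 = 1`. -/
noncomputable def qPoch (a q : ℂ) (n : ℕ) : ℂ := ∏ k ∈ Finset.range n, (1 - a * q ^ k)

/-- The infinite `q`-Pochhammer symbol `(a;q)_∞ = ∏_{k ≥ 0} (1 - a q^k)`, for `|q| < 1`.
It is the limit of `(a;q)_n`, see `tendsto_qPoch`. -/
noncomputable def qPochInf (a q : ℂ) : ℂ := ∏' k : ℕ, (1 - a * q ^ k)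

/-- The Rogers–Ramanujan function `G(q) = ∑_{n ≥ 0} q^{n^2} / (q;q)_n`, for `|q| < 1`. -/
noncomputable def G (q : ℂ) : ℂ := ∑' n : ℕ, q ^ (n ^ 2) / qPoch q q n

/-- The Rogers–Ramanujan function `H(q) = ∑_{n ≥ 0} q^{n(n+1)} / (q;q)_n`, for `|q| < 1`. -/
noncomputable def H (q : ℂ) : ℂ := ∑' n : ℕ, q ^ (n * (n + 1)) / qPoch q q n

/-! The infinite product and the two series converge for `|q| < 1`. -/

theorem summable_neg_mul_pow (a : ℂ) {q : ℂ} (hq : ‖q‖ < 1) :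
    Summable fun k : ℕ => ‖-(a * q ^ k)‖ := by
  simp only [norm_neg, norm_mul, norm_pow]
  exact (summable_geometric_of_lt_one (norm_nonneg q) hq).mul_left _

theorem tendsto_qPoch (a : ℂ) {q : ℂ} (hq : ‖q‖ < 1) :
    Tendsto (fun n => qPoch a q n) atTop (𝓝 (qPochInf a q)) := by
  have h : Multipliable fun k : ℕ => 1 - a * q ^ k := by
    simpa only [sub_eq_add_neg] using multipliable_one_add_of_summable (summable_neg_mul_pow a hq)
  exact h.hasProd.tendsto_prod_nat

theorem one_sub_ne_zero {q : ℂ} (hq : ‖q‖ < 1) (k : ℕ) : 1 + -(q * q ^ k) ≠ 0 := by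
  intro h
  have h1 : q ^ (k + 1) = 1 := by rw [pow_succ']; linear_combination -h
  have h2 : ‖q‖ ^ (k + 1) = 1 := by rw [← norm_pow, h1, norm_one]
  exact absurd h2 (pow_lt_one₀ (norm_nonneg q) hq k.succ_ne_zero).ne

theorem qPochInf_ne_zero {q : ℂ} (hq : ‖q‖ < 1) : qPochInf q q ≠ 0 := by
  have h := tprod_one_add_ne_zero_of_summable (f := fun k : ℕ => -(q * q ^ k))
    (one_sub_ne_zero hq) (summable_neg_mul_pow q hq)
  simpa only [qPochInf, sub_eq_add_neg] using h

theorem summable_div_qPoch {q : ℂ} (hq : ‖q‖ < 1) {e : ℕ → ℕ} (he : ∀ n, n ≤ e n) :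
    Summable fun n : ℕ => q ^ e n / qPoch q q n := by
  have hb := ((tendsto_qPoch q hq).inv₀ (qPochInf_ne_zero hq)).norm.bddAbove_range
  obtain ⟨C, hC⟩ := hb
  refine Summable.of_norm_bounded
    ((summable_geometric_of_lt_one (norm_nonneg q) hq).mul_right C) fun n => ?_
  rw [div_eq_mul_inv, norm_mul, norm_pow]
  exact mul_le_mul (pow_le_pow_of_le_one (norm_nonneg q) hq.le (he n))
    (hC ⟨n, rfl⟩) (norm_nonneg _) (by positivity)

theorem hasSum_G {q : ℂ} (hq : ‖q‖ < 1) :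
    HasSum (fun n : ℕ => q ^ (n ^ 2) / qPoch q q n) (G q) :=
  (summable_div_qPoch hq fun n => Nat.le_self_pow two_ne_zero n).hasSum

theorem hasSum_H {q : ℂ} (hq : ‖q‖ < 1) :
    HasSum (fun n : ℕ => q ^ (n * (n + 1)) / qPoch q q n) (H q) :=
  (summable_div_qPoch hq fun n => Nat.le_mul_of_pos_right n n.succ_pos).hasSum

end RogersRamanujan

open Filter Topology

namespace RogersRamanujan

/-! Write [z;q] = (z;q)_∞ (q/z;q)_∞ (this is `qPair`). For q ≠ 0 the Rogers–Ramanujan identities say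
G(q) = 1/[q;q^5] and H(q) = 1/[q^2;q^5], which already gives G, H ≠ 0. They come from the Bailey
chain: two steps (`sum_tsum_mul_invPoch`) starting from the unit Bailey pair, followed by N → ∞,
turn both series into theta series of base q^5, and the Jacobi triple product (`theta_eq_prod`)
factors these.

Each quotient of G's and H's is then dissected to a common base, q^30 for the first identity and
q^15 with signed arguments for the second. Almost everything cancels, and what remains is one
instance of Weierstrass's three-term relation (`qPair_three_term`). That relation holds because
theta(xy) theta(x/y) is x times a 2×2 determinant in x and y (`theta_mul_theta`), so it is a Plücker
relation.

For the right-hand sides, sorting factors modulo 6 gives (q;q)_∞ (q^6;q^6)_∞ = [q;q^6] (q^2;q^2)_∞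
(q^3;q^3)_∞, and [q;q^6] [-q;q^3] = 1. With q replaced by q^5, the eta quotients become [q^5;q^30]^2
and its inverse [-q^5;q^15]^2. -/

/-- The reciprocal `1 / (q;q)_n`, extended by zero to negative `n`. -/
noncomputable def invPoch (q : ℂ) (n : ℤ) : ℂ := if n < 0 then 0 else (qPoch q q n.toNat)⁻¹

/-- The general term `(-1)^r q^{r(r-1)/2} z^r` of the theta series. -/
noncomputable def thetaTerm (q z : ℂ) (r : ℤ) : ℂ := (-1) ^ r * q ^ (r * (r - 1) / 2) * z ^ r

/-- The theta function `∑_{r ∈ ℤ} (-1)^r q^{r(r-1)/2} z^r`. -/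
noncomputable def theta (q z : ℂ) : ℂ := ∑' r : ℤ, thetaTerm q z r

/-! ### Reciprocal q-factorials and theta terms -/

theorem one_sub_pow_ne_zero {q : ℂ} (hq : ‖q‖ < 1) (k : ℕ) : 1 - q ^ (k + 1) ≠ 0 := by
  have h := one_sub_ne_zero hq k
  rwa [← pow_succ', ← sub_eq_add_neg] at h

theorem qPoch_succ (a q : ℂ) (n : ℕ) : qPoch a q (n + 1) = qPoch a q n * (1 - a * q ^ n) := by
  simp [qPoch, Finset.prod_range_succ]

theorem qPoch_zero (a q : ℂ) : qPoch a q 0 = 1 := by simp [qPoch]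

theorem qPoch_self_ne_zero {q : ℂ} (hq : ‖q‖ < 1) (n : ℕ) : qPoch q q n ≠ 0 := by
  refine Finset.prod_ne_zero_iff.2 fun k _ => ?_
  rw [← pow_succ']
  exact one_sub_pow_ne_zero hq k

theorem invPoch_natCast (q : ℂ) (n : ℕ) : invPoch q n = (qPoch q q n)⁻¹ := by
  simp [invPoch]

theorem invPoch_of_neg (q : ℂ) {n : ℤ} (hn : n < 0) : invPoch q n = 0 := by
  simp [invPoch, hn]

theorem invPoch_zero (q : ℂ) : invPoch q 0 = 1 := by simp [invPoch, qPoch_zero]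

/-- Extension by zero makes this hold for every integer: at k = 0 the factor 1 - q^0 vanishes along
with the left side. Sums over r can therefore run over all of ℤ, without boundary terms. -/
theorem invPoch_sub_one {q : ℂ} (hq : ‖q‖ < 1) (k : ℤ) :
    invPoch q (k - 1) = (1 - q ^ k) * invPoch q k := by
  rcases lt_trichotomy k 0 with h | rfl | h
  · rw [invPoch_of_neg q h, invPoch_of_neg q (by omega), mul_zero]
  · rw [invPoch_of_neg q (by omega)]; simp
  · obtain ⟨n, rfl⟩ : ∃ n : ℕ, k = n + 1 := ⟨(k - 1).toNat, by omega⟩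
    rw [add_sub_cancel_right, invPoch_natCast]
    have : ((n : ℤ) + 1) = ((n + 1 : ℕ) : ℤ) := by push_cast; rfl
    rw [this, invPoch_natCast, zpow_natCast, qPoch_succ, mul_inv, ← pow_succ', mul_left_comm,
      mul_inv_cancel₀ (one_sub_pow_ne_zero hq n), mul_one]

theorem tendsto_invPoch {q : ℂ} (hq : ‖q‖ < 1) :
    Tendsto (invPoch q) atTop (𝓝 (qPochInf q q)⁻¹) := by
  have h := (tendsto_qPoch q hq).inv₀ (qPochInf_ne_zero hq)
  have h2 : Tendsto Int.toNat atTop atTop :=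
    tendsto_atTop.2 fun b => (eventually_ge_atTop (b : ℤ)).mono fun n hn => by omega
  refine (h.comp h2).congr' ?_
  filter_upwards [eventually_ge_atTop (0 : ℤ)] with n hn
  simp [invPoch, hn.not_gt]

theorem exists_norm_invPoch_le {q : ℂ} (hq : ‖q‖ < 1) : ∃ C, ∀ n, ‖invPoch q n‖ ≤ C := by
  obtain ⟨C, hC⟩ := ((tendsto_qPoch q hq).inv₀ (qPochInf_ne_zero hq)).norm.bddAbove_range
  refine ⟨max C 0, fun n => ?_⟩
  unfold invPoch
  split_ifs with h
  · simp
  · exact (hC ⟨n.toNat, rfl⟩).trans (le_max_left _ _)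

theorem thetaTerm_zero (q z : ℂ) : thetaTerm q z 0 = 1 := by simp [thetaTerm]

theorem two_mul_choose (r : ℤ) : 2 * (r * (r - 1) / 2) = r * (r - 1) :=
  Int.two_mul_ediv_two_of_even (Int.even_mul_pred_self r)

theorem thetaTerm_add_one {q z : ℂ} (hq : q ≠ 0) (hz : z ≠ 0) (r : ℤ) :
    thetaTerm q z (r + 1) = -(q ^ r * z) * thetaTerm q z r := by
  have h : (r + 1) * (r + 1 - 1) / 2 = r * (r - 1) / 2 + r := by
    have h1 := two_mul_choose r
    have h2 := two_mul_choose (r + 1)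
    linarith
  unfold thetaTerm
  rw [h, zpow_add₀ hq, zpow_add_one₀ hz, zpow_add_one₀ (by norm_num)]
  ring

theorem summable_mul_invPoch (q : ℂ) (f : ℤ → ℂ) (m n : ℤ) :
    Summable fun r => f r * invPoch q (m - r) * invPoch q (n + r) := by
  refine summable_of_hasFiniteSupport ((Set.finite_Icc (-n) m).subset fun r hr => ?_)
  by_contra h
  apply hr
  rw [Set.mem_Icc, not_and_or, not_le, not_le] at h
  rcases h with h | h
  · simp [invPoch_of_neg q (show n + r < 0 by omega)]
  · simp [invPoch_of_neg q (show m - r < 0 by omega)]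

/-! ### Finite Jacobi triple product and q-Vandermonde -/

theorem tsum_thetaTerm_succ_left {q z : ℂ} (hq : ‖q‖ < 1) (h0 : q ≠ 0) (hz : z ≠ 0) (m n : ℤ) :
    (1 - q ^ (m + n + 1)) * ∑' r, thetaTerm q z r * invPoch q (m + 1 - r) * invPoch q (n + r)
      = (1 - z * q ^ m) * ∑' r, thetaTerm q z r * invPoch q (m - r) * invPoch q (n + r) := by
  have hs := summable_mul_invPoch q (thetaTerm q z) m n
  have he := (Equiv.subRight (1 : ℤ)).tsum_eq
    fun r => thetaTerm q z r * invPoch q (m - r) * invPoch q (n + r)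
  have hs' := (Equiv.subRight (1 : ℤ)).summable_iff.2 hs
  rw [sub_mul 1 (z * q ^ m), one_mul]
  nth_rewrite 2 [← he]
  have hsub := hs.tsum_sub (hs'.mul_left (z * q ^ m))
  simp only [Function.comp_apply] at hsub
  rw [← tsum_mul_left, ← tsum_mul_left, ← hsub]
  -- With A = q^(m+1-r) and B = q^(n+r), the identity is 1 - AB = (1 - A) + A(1 - B). Each bracket
  -- lowers one reciprocal factorial, and the second part is the original summand shifted by one.
  refine tsum_congr fun r => ?_
  simp only [Equiv.subRight_apply]
  have h1 := thetaTerm_add_one h0 hz (r - 1)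
  have h2 := invPoch_sub_one hq (m + 1 - r)
  have h3 := invPoch_sub_one hq (n + r)
  rw [sub_add_cancel] at h1
  rw [show m + 1 - r - 1 = m - r by ring] at h2
  rw [show m - (r - 1) = m + 1 - r by ring, show n + (r - 1) = n + r - 1 by ring, h1, h2, h3]
  rw [show m + n + 1 = (m + 1 - r) + (n + r) by ring, zpow_add₀ h0 (m + 1 - r)]
  have h4 : q ^ m = q ^ (m + 1 - r) * q ^ (r - 1) := by
    rw [← zpow_add₀ h0]; congr 1; ring
  rw [h4]
  ring

theorem tsum_thetaTerm_succ_right {q z : ℂ} (hq : ‖q‖ < 1) (h0 : q ≠ 0) (hz : z ≠ 0) (m n : ℤ) :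
    (1 - q ^ (m + n + 1)) * ∑' r, thetaTerm q z r * invPoch q (m - r) * invPoch q (n + 1 + r)
      = (1 - q / z * q ^ n) * ∑' r, thetaTerm q z r * invPoch q (m - r) * invPoch q (n + r) := by
  have hs := summable_mul_invPoch q (thetaTerm q z) m n
  have he := (Equiv.addRight (1 : ℤ)).tsum_eq
    fun r => thetaTerm q z r * invPoch q (m - r) * invPoch q (n + r)
  have hs' := (Equiv.addRight (1 : ℤ)).summable_iff.2 hs
  rw [sub_mul 1 (q / z * q ^ n), one_mul]
  nth_rewrite 2 [← he]
  have hsub := hs.tsum_sub (hs'.mul_left (q / z * q ^ n))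
  simp only [Function.comp_apply] at hsub
  rw [← tsum_mul_left, ← tsum_mul_left, ← hsub]
  refine tsum_congr fun r => ?_
  simp only [Equiv.coe_addRight]
  have h1 := thetaTerm_add_one h0 hz r
  have h2 := invPoch_sub_one hq (n + 1 + r)
  have h3 := invPoch_sub_one hq (m - r)
  rw [show n + 1 + r - 1 = n + r by ring] at h2
  rw [show m - (r + 1) = m - r - 1 by ring, show n + (r + 1) = n + 1 + r by ring, h1, h2, h3]
  rw [show m + n + 1 = (n + 1 + r) + (m - r) by ring, zpow_add₀ h0 (n + 1 + r)]
  have h4 : q ^ (n + 1 + r) = q * q ^ n * q ^ r := by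
    rw [zpow_add₀ h0, zpow_add_one₀ h0]; ring
  rw [h4]
  field_simp
  ring

/-- The finite form of the Jacobi triple product. -/
theorem tsum_thetaTerm_mul_invPoch {q z : ℂ} (hq : ‖q‖ < 1) (h0 : q ≠ 0) (hz : z ≠ 0) (m n : ℕ) :
    ∑' r, thetaTerm q z r * invPoch q (m - r) * invPoch q (n + r)
      = qPoch z q m * qPoch (q / z) q n * invPoch q ((m + n : ℕ) : ℤ) := by
  have hcancel : ∀ k : ℕ, ∀ a b c d e : ℂ, (1 - q ^ (k + 1)) * a = b * c →
      c = d * invPoch q (k : ℤ) → e = b * d → a = e * invPoch q ((k + 1 : ℕ) : ℤ) := by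
    intro k a b c d e h1 h2 h3
    have h4 := invPoch_sub_one hq ((k + 1 : ℕ) : ℤ)
    rw [zpow_natCast] at h4
    rw [show (((k + 1 : ℕ) : ℤ) - 1) = k by push_cast; ring] at h4
    refine mul_left_cancel₀ (one_sub_pow_ne_zero hq k) ?_
    rw [h1, h2, h3, h4]; ring
  induction n with
  | zero =>
    induction m with
    | zero =>
      rw [tsum_eq_single 0]
      · simp [thetaTerm_zero, invPoch_zero, qPoch_zero]
      · intro r hr
        rcases lt_or_gt_of_ne hr with h | h
        · rw [invPoch_of_neg q (n := ((0 : ℕ) : ℤ) + r) (by simpa using h)]; simp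
        · rw [invPoch_of_neg q (n := ((0 : ℕ) : ℤ) - r) (by simpa using h)]; simp
    | succ m ih =>
      have h := tsum_thetaTerm_succ_left hq h0 hz m ((0 : ℕ) : ℤ)
      rw [show ((m : ℤ) + ((0 : ℕ) : ℤ) + 1) = ((m + 1 : ℕ) : ℤ) by push_cast; ring,
        zpow_natCast, zpow_natCast] at h
      push_cast at h ih ⊢
      have := hcancel m _ _ _ _ (qPoch z q (m + 1) * qPoch (q / z) q 0) h (by simpa using ih)
        (by rw [qPoch_succ]; ring)
      simpa using this
  | succ n ih =>
    have h := tsum_thetaTerm_succ_right hq h0 hz m n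
    rw [show ((m : ℤ) + (n : ℤ) + 1) = ((m + n + 1 : ℕ) : ℤ) by push_cast; ring,
      zpow_natCast, zpow_natCast] at h
    have := hcancel (m + n) _ _ _ _ (qPoch z q m * qPoch (q / z) q (n + 1)) h ih
      (by rw [qPoch_succ]; ring)
    rw [← add_assoc, ← this]
    push_cast
    rfl

/-- A `q`-Chu–Vandermonde summation. -/
theorem tsum_invPoch_vandermonde {q : ℂ} (hq : ‖q‖ < 1) (h0 : q ≠ 0) (n : ℕ) (m : ℤ) :
    ∑' i : ℤ, q ^ (i * (i + m)) * invPoch q (n - i) * invPoch q i * invPoch q (i + m)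
      = invPoch q n * invPoch q (n + m) := by
  have hsum : ∀ (f : ℤ → ℂ) (n : ℤ), Summable fun i => f i * invPoch q (n - i) * invPoch q i :=
    fun f n => by simpa using summable_mul_invPoch q f n 0
  induction n generalizing m with
  | zero =>
    rw [tsum_eq_single 0]
    · simp [invPoch_zero]
    · intro r hr
      rcases lt_or_gt_of_ne hr with h | h
      · rw [invPoch_of_neg q h]; simp
      · rw [invPoch_of_neg q (n := ((0 : ℕ) : ℤ) - r) (by simpa using h)]; simp
  | succ n ih =>
    have h4 := invPoch_sub_one hq ((n + 1 : ℕ) : ℤ)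
    rw [show (((n + 1 : ℕ) : ℤ) - 1) = n by push_cast; ring, zpow_natCast] at h4
    refine mul_left_cancel₀ (one_sub_pow_ne_zero hq n) ?_
    rw [← mul_assoc, ← h4, show (((n + 1 : ℕ) : ℤ) + m) = n + (m + 1) by push_cast; ring, ← ih,
      ← tsum_mul_left]
    -- The splitting 1 - q^(n+1) = (1 - q^i) + q^i (1 - q^(n+1-i)) breaks the sum for (n+1, m) into
    -- a shifted g-part and an f-part; unshifted, f and g add up to the summand for (n, m+1). Hence
    -- the induction on n with m free.
    set f : ℤ → ℂ := fun i => q ^ (i * (i + m) + i) * invPoch q (i + m)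
    set g : ℤ → ℂ := fun i => q ^ ((i + 1) * (i + 1 + m)) * invPoch q (i + 1 + m)
    have hf := hsum f n
    have hg := hsum g n
    have he := (Equiv.subRight (1 : ℤ)).tsum_eq fun i => g i * invPoch q (n - i) * invPoch q i
    have hg' := (Equiv.subRight (1 : ℤ)).summable_iff.2 hg
    have key : ∀ i : ℤ, q ^ (i * (i + (m + 1))) * invPoch q (n - i) * invPoch q i
        * invPoch q (i + (m + 1)) = f i * invPoch q (n - i) * invPoch q i
          + g i * invPoch q (n - i) * invPoch q i := by
      intro i
      have h5 := invPoch_sub_one hq (i + 1 + m)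
      rw [show i + 1 + m - 1 = i + m by ring] at h5
      simp only [f, g]
      rw [h5, show i + (m + 1) = i + 1 + m by ring,
        show (i + 1) * (i + 1 + m) = i * (i + 1 + m) + (i + 1 + m) by ring,
        show i * (i + m) + i = i * (i + 1 + m) by ring, zpow_add₀ h0 (i * (i + 1 + m))]
      ring
    rw [tsum_congr key, hf.tsum_add hg, ← he]
    have hadd := hf.tsum_add hg'
    simp only [Function.comp, Equiv.subRight_apply] at hadd ⊢
    rw [← hadd]
    refine tsum_congr fun i => ?_
    have h5 := invPoch_sub_one hq i
    have h6 := invPoch_sub_one hq (n + 1 - i)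
    rw [show (n : ℤ) + 1 - i - 1 = n - i by ring] at h6
    simp only [f, g]
    rw [h5, h6, show (n : ℤ) - (i - 1) = n + 1 - i by ring, sub_add_cancel,
      show ((n + 1 : ℕ) : ℤ) = (n : ℤ) + 1 by push_cast; ring, zpow_add₀ h0 (i * (i + m))]
    have h7 : q ^ (n + 1) = q ^ i * q ^ ((n : ℤ) + 1 - i) := by
      rw [← zpow_add₀ h0, ← zpow_natCast]; congr 1; push_cast; ring
    rw [h7]
    ring


/-! ### Convergence of theta series and the Jacobi triple product -/

theorem thetaTerm_ne_zero {q z : ℂ} (h0 : q ≠ 0) (hz : z ≠ 0) (r : ℤ) : thetaTerm q z r ≠ 0 :=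
  mul_ne_zero (mul_ne_zero (zpow_ne_zero _ (by norm_num)) (zpow_ne_zero _ h0)) (zpow_ne_zero _ hz)

theorem summable_norm_thetaTerm {q z : ℂ} (hq : ‖q‖ < 1) (h0 : q ≠ 0) (hz : z ≠ 0) :
    Summable fun r : ℤ => ‖thetaTerm q z r‖ := by
  have hne : ∀ r, ‖thetaTerm q z r‖ ≠ 0 := fun r => norm_ne_zero_iff.2 (thetaTerm_ne_zero h0 hz r)
  have hpow := tendsto_pow_atTop_nhds_zero_of_lt_one (norm_nonneg q) hq
  refine Summable.of_nat_of_neg_add_one ?_ ?_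
  · refine summable_of_ratio_test_tendsto_lt_one zero_lt_one (Eventually.of_forall fun n => hne n) ?_
    have : Tendsto (fun n : ℕ => ‖q‖ ^ n * ‖z‖) atTop (𝓝 0) := by
      simpa using hpow.mul_const ‖z‖
    refine this.congr fun n => ?_
    rw [norm_norm, norm_norm]
    push_cast
    rw [thetaTerm_add_one h0 hz, norm_mul, mul_div_cancel_right₀ _ (hne n)]
    simp
  · refine summable_of_ratio_test_tendsto_lt_one zero_lt_one
      (Eventually.of_forall fun n => hne (-((n : ℤ) + 1))) ?_
    have : Tendsto (fun n : ℕ => ‖q‖ ^ (n + 2) * ‖z‖⁻¹) atTop (𝓝 0) := by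
      simpa using ((tendsto_add_atTop_iff_nat 2).2 hpow).mul_const ‖z‖⁻¹
    refine this.congr fun n => ?_
    rw [norm_norm, norm_norm]
    have h := thetaTerm_add_one h0 hz (-(((n + 1 : ℕ) : ℤ) + 1))
    rw [show -(((n + 1 : ℕ) : ℤ) + 1) + 1 = -((n : ℤ) + 1) by push_cast; ring] at h
    have hz' := norm_ne_zero_iff.2 hz
    have h0' := norm_ne_zero_iff.2 h0
    rw [h, norm_mul, norm_neg, norm_mul, norm_zpow,
      show -(((n + 1 : ℕ) : ℤ) + 1) = -((n + 2 : ℕ) : ℤ) by push_cast; ring, zpow_neg, zpow_natCast]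
    have := hne (-((n + 2 : ℕ) : ℤ))
    field_simp

/-- Tannery's theorem: the reciprocal factorials are uniformly bounded and each tends to 1/(q;q)_∞.
-/
theorem tendsto_tsum_mul_invPoch {q : ℂ} (hq : ‖q‖ < 1) {b : ℤ → ℂ} (hb : Summable fun r => ‖b r‖)
    (c : ℕ) :
    Tendsto (fun N : ℕ => ∑' r, b r * invPoch q (N - r) * invPoch q ((N + c : ℕ) + r)) atTop
      (𝓝 ((∑' r, b r) * (qPochInf q q)⁻¹ * (qPochInf q q)⁻¹)) := by
  obtain ⟨C, hC⟩ := exists_norm_invPoch_le hq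
  have hC0 : 0 ≤ C := (norm_nonneg _).trans (hC 0)
  rw [← tsum_mul_right, ← tsum_mul_right]
  refine tendsto_tsum_of_dominated_convergence (bound := fun r => ‖b r‖ * C * C)
    ((hb.mul_right C).mul_right C) (fun r => ?_) (Eventually.of_forall fun N r => ?_)
  · refine (tendsto_const_nhds.mul ((tendsto_invPoch hq).comp ?_)).mul
      ((tendsto_invPoch hq).comp ?_)
    · exact tendsto_atTop_add_const_right _ (-r) tendsto_natCast_atTop_atTop
    · exact tendsto_atTop_add_const_right _ r
        (tendsto_natCast_atTop_atTop.comp (tendsto_add_atTop_nat c))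
  · rw [norm_mul, norm_mul]
    gcongr
    · exact hC _
    · exact hC _

/-- The Jacobi triple product identity. -/
theorem theta_eq_prod {q z : ℂ} (hq : ‖q‖ < 1) (h0 : q ≠ 0) (hz : z ≠ 0) :
    theta q z = qPochInf q q * qPochInf z q * qPochInf (q / z) q := by
  have h1 := tendsto_tsum_mul_invPoch hq (summable_norm_thetaTerm hq h0 hz) 0
  have h2 : Tendsto (fun N : ℕ => qPoch z q N * qPoch (q / z) q N * invPoch q ((N + N : ℕ) : ℤ))
      atTop (𝓝 (qPochInf z q * qPochInf (q / z) q * (qPochInf q q)⁻¹)) := by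
    refine ((tendsto_qPoch z hq).mul (tendsto_qPoch (q / z) hq)).mul ((tendsto_invPoch hq).comp
      (tendsto_natCast_atTop_atTop.comp (tendsto_id.atTop_add_nonneg fun n => n.zero_le)))
  have h3 := tendsto_nhds_unique h1 (h2.congr fun N => (tsum_thetaTerm_mul_invPoch hq h0 hz N N).symm)
  have hP := qPochInf_ne_zero hq
  rw [theta]
  field_simp at h3
  linear_combination h3

/-! ### The Bailey chain and the Rogers–Ramanujan series as theta series -/

theorem sum_invPoch_mul {q : ℂ} (hq : ‖q‖ < 1) (h0 : q ≠ 0) {c : ℕ} (hc : c ≤ 1) (N : ℕ) (r : ℤ) :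
    ∑ s ∈ Finset.range (N + 1), q ^ (s * (s + c)) * invPoch q (N - s) *
        (invPoch q (s - r) * invPoch q ((s + c : ℕ) + r))
      = q ^ (r * (r + c)) * invPoch q (N - r) * invPoch q ((N + c : ℕ) + r) := by
  rcases lt_or_ge (N : ℤ) r with hr | hr
  · rw [invPoch_of_neg q (n := N - r) (by omega), mul_zero, zero_mul]
    refine Finset.sum_eq_zero fun s hs => ?_
    rw [Finset.mem_range] at hs
    rw [invPoch_of_neg q (n := s - r) (by omega), zero_mul, mul_zero]
  · set F : ℤ → ℂ := fun s => q ^ (s * (s + c)) * invPoch q (N - s) *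
        (invPoch q (s - r) * invPoch q (s + c + r))
    have h1 : ∑' s, F s = ∑ s ∈ Finset.range (N + 1), F s := by
      rw [tsum_eq_sum (s := (Finset.range (N + 1)).map Nat.castEmbedding), Finset.sum_map]
      · rfl
      · intro s hs
        simp only [F]
        -- A nonzero term needs s ≥ r and s ≥ -c - r, so 2s ≥ -c. Only because c ≤ 1 does this
        -- exclude every negative s.
        rcases lt_or_ge s 0 with h | h
        · rcases lt_or_ge (s - r) 0 with h' | h'
          · rw [invPoch_of_neg q h']; simp
          · rw [invPoch_of_neg q (n := s + c + r) (by omega)]; simp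
        · rw [invPoch_of_neg q (n := N - s)]
          · simp
          · by_contra h'
            refine hs (Finset.mem_map.2 ⟨s.toNat, ?_, ?_⟩)
            · rw [Finset.mem_range]; omega
            · simpa using h
    obtain ⟨n, hn⟩ : ∃ n : ℕ, (n : ℤ) = N - r := ⟨(N - r).toNat, by omega⟩
    -- Substituting s = i + r gives s(s+c) = r(r+c) + i(i+2r+c), which is the Vandermonde exponent
    -- with m = 2r + c.
    have h2 := tsum_invPoch_vandermonde hq h0 n (2 * r + c)
    have h3 := (Equiv.addRight r).tsum_eq F
    have h4 : ∀ s : ℕ, q ^ (s * (s + c)) * invPoch q (N - s) *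
        (invPoch q (s - r) * invPoch q ((s + c : ℕ) + r)) = F s := by
      intro s
      simp only [F]
      rw [← zpow_natCast]
      push_cast
      rfl
    rw [Finset.sum_congr rfl fun s _ => h4 s, ← h1, ← h3, mul_assoc, ← hn,
      show ((N + c : ℕ) : ℤ) + r = n + (2 * r + c) by rw [hn]; push_cast; ring, ← h2,
      ← tsum_mul_left]
    refine tsum_congr fun i => ?_
    simp only [F, Equiv.coe_addRight]
    rw [show (i + r) * (i + r + c) = r * (r + c) + i * (i + (2 * r + c)) by ring, zpow_add₀ h0,
      add_sub_cancel_right, show (N : ℤ) - (i + r) = n - i by rw [hn]; ring,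
      show i + r + c + r = i + (2 * r + c) by ring]
    ring

/-- One step of the Bailey chain. -/
theorem sum_tsum_mul_invPoch {q : ℂ} (hq : ‖q‖ < 1) (h0 : q ≠ 0) {c : ℕ} (hc : c ≤ 1) (N : ℕ)
    (a : ℤ → ℂ) :
    ∑ s ∈ Finset.range (N + 1), q ^ (s * (s + c)) * invPoch q (N - s) *
        ∑' r, a r * invPoch q (s - r) * invPoch q ((s + c : ℕ) + r)
      = ∑' r, a r * q ^ (r * (r + c)) * invPoch q (N - r) * invPoch q ((N + c : ℕ) + r) := by
  simp_rw [← tsum_mul_left]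
  rw [← Summable.tsum_finsetSum fun (s : ℕ) _ =>
    (summable_mul_invPoch q a (s : ℤ) ((s + c : ℕ) : ℤ)).mul_left _]
  refine tsum_congr fun r => ?_
  rw [mul_assoc (a r * _), mul_assoc (a r), ← mul_assoc (q ^ _), ← sum_invPoch_mul hq h0 hc,
    Finset.mul_sum]
  exact Finset.sum_congr rfl fun s _ => by ring

/-- The unit Bailey pair: at z = 1 the finite triple product contains (1;q)_s, whose first factor is
0 once s ≥ 1. -/
theorem tsum_thetaTerm_one_mul_invPoch {q : ℂ} (hq : ‖q‖ < 1) (h0 : q ≠ 0) (c s : ℕ) :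
    ∑' r, thetaTerm q 1 r * invPoch q (s - r) * invPoch q ((s + c : ℕ) + r)
      = if s = 0 then 1 else 0 := by
  rw [tsum_thetaTerm_mul_invPoch hq h0 one_ne_zero, div_one]
  split_ifs with h
  · subst h
    rw [qPoch_zero, invPoch_natCast, one_mul, zero_add, zero_add,
      mul_inv_cancel₀ (qPoch_self_ne_zero hq c)]
  · obtain ⟨n, rfl⟩ := Nat.exists_eq_succ_of_ne_zero h
    have : qPoch 1 q n.succ = 0 := by
      rw [qPoch]
      exact Finset.prod_eq_zero (Finset.mem_range.2 n.succ_pos) (by simp)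
    rw [this, zero_mul, zero_mul]

theorem invPoch_eq_tsum {q : ℂ} (hq : ‖q‖ < 1) (h0 : q ≠ 0) {c : ℕ} (hc : c ≤ 1) (N : ℕ) :
    ∑' r, thetaTerm q 1 r * q ^ (r * (r + c)) * invPoch q (N - r) * invPoch q ((N + c : ℕ) + r)
      = invPoch q N := by
  rw [← sum_tsum_mul_invPoch hq h0 hc]
  simp_rw [tsum_thetaTerm_one_mul_invPoch hq h0]
  simp

/-- Each Bailey step contributes q^(r(r+c)); two of them raise the quadratic exponent r²/2 to 5r²/2,
which is where the modulus 5 comes from. -/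
theorem thetaTerm_one_mul {q : ℂ} (h0 : q ≠ 0) (c : ℕ) (r : ℤ) :
    thetaTerm q 1 r * q ^ (r * (r + c)) * q ^ (r * (r + c))
      = thetaTerm (q ^ 5) (q ^ (2 * c + 2)) r := by
  unfold thetaTerm
  have h := two_mul_choose r
  rw [one_zpow, mul_one, mul_assoc, mul_assoc, mul_assoc, ← zpow_natCast, ← zpow_natCast,
    ← zpow_mul, ← zpow_mul, ← zpow_add₀ h0, ← zpow_add₀ h0, ← zpow_add₀ h0]
  congr 2
  push_cast
  linarith

theorem sum_invPoch_mul_invPoch {q : ℂ} (hq : ‖q‖ < 1) (h0 : q ≠ 0) {c : ℕ} (hc : c ≤ 1) (N : ℕ) :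
    ∑ s ∈ Finset.range (N + 1), q ^ (s * (s + c)) * invPoch q (N - s) * invPoch q s
      = ∑' r, thetaTerm (q ^ 5) (q ^ (2 * c + 2)) r * invPoch q (N - r)
          * invPoch q ((N + c : ℕ) + r) := by
  simp_rw [← thetaTerm_one_mul h0]
  rw [← sum_tsum_mul_invPoch hq h0 hc N fun r => thetaTerm q 1 r * q ^ (r * (r + c))]
  simp_rw [invPoch_eq_tsum hq h0 hc]

/-- The limit N → ∞ of the doubly iterated chain; c = 0 gives G and c = 1 gives H. -/
theorem tsum_div_qPoch_eq_theta {q : ℂ} (hq : ‖q‖ < 1) (h0 : q ≠ 0) {c : ℕ} (hc : c ≤ 1) :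
    qPochInf q q * ∑' n : ℕ, q ^ (n * (n + c)) / qPoch q q n = theta (q ^ 5) (q ^ (2 * c + 2)) := by
  have hq5 : ‖q ^ 5‖ < 1 := by
    rw [norm_pow]; exact pow_lt_one₀ (norm_nonneg q) hq (by norm_num)
  have h1 := tendsto_tsum_mul_invPoch hq
    (summable_norm_thetaTerm hq5 (pow_ne_zero 5 h0) (pow_ne_zero (2 * c + 2) h0)) c
  obtain ⟨C, hC⟩ := exists_norm_invPoch_le hq
  have hs : Summable fun n : ℕ => q ^ (n * (n + c)) / qPoch q q n := by
    refine summable_div_qPoch hq fun n => ?_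
    nlinarith [Nat.le_mul_self n]
  have h2 : Tendsto (fun N : ℕ => ∑' s : ℕ, q ^ (s * (s + c)) / qPoch q q s * invPoch q (N - s))
      atTop (𝓝 ((∑' s : ℕ, q ^ (s * (s + c)) / qPoch q q s) * (qPochInf q q)⁻¹)) := by
    rw [← tsum_mul_right]
    refine tendsto_tsum_of_dominated_convergence
      (bound := fun s => ‖q ^ (s * (s + c)) / qPoch q q s‖ * C)
      (hs.norm.mul_right C) (fun s => ?_) (Eventually.of_forall fun N s => ?_)
    · exact tendsto_const_nhds.mul ((tendsto_invPoch hq).comp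
        (tendsto_atTop_add_const_right _ (-(s : ℤ)) tendsto_natCast_atTop_atTop))
    · rw [norm_mul]
      gcongr
      exact hC _
  have h3 := tendsto_nhds_unique h1 (h2.congr fun N => ?_)
  · have hP := qPochInf_ne_zero hq
    rw [theta]
    field_simp at h3
    linear_combination -h3
  · rw [← sum_invPoch_mul_invPoch hq h0 hc, tsum_eq_sum (s := Finset.range (N + 1))]
    · exact Finset.sum_congr rfl fun s _ => by rw [invPoch_natCast]; ring
    · intro s hs
      rw [Finset.mem_range] at hs
      rw [invPoch_of_neg q (by omega), mul_zero]

theorem qPochInf_mul_G {q : ℂ} (hq : ‖q‖ < 1) (h0 : q ≠ 0) :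
    qPochInf q q * G q = theta (q ^ 5) (q ^ 2) := by
  simpa [G, sq] using tsum_div_qPoch_eq_theta hq h0 (c := 0) zero_le_one

theorem qPochInf_mul_H {q : ℂ} (hq : ‖q‖ < 1) (h0 : q ≠ 0) :
    qPochInf q q * H q = theta (q ^ 5) (q ^ 4) := by
  simpa [H] using tsum_div_qPoch_eq_theta hq h0 (c := 1) le_rfl


/-! ### Products of two theta functions and the three-term relation -/

theorem theta_mul_base {q z : ℂ} (h0 : q ≠ 0) (hz : z ≠ 0) :
    z * theta q (q * z) = -theta q z := by
  rw [theta, theta, ← tsum_mul_left, ← (Equiv.addRight (1 : ℤ)).tsum_eq (thetaTerm q z), ← tsum_neg]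
  refine tsum_congr fun r => ?_
  rw [Equiv.coe_addRight, thetaTerm_add_one h0 hz]
  unfold thetaTerm
  rw [mul_zpow]
  ring

theorem thetaTerm_mul_thetaTerm {q x y : ℂ} (h0 : q ≠ 0) (hx : x ≠ 0) (hy : y ≠ 0) (m n : ℤ) :
    thetaTerm q (x * y) m * thetaTerm q (x / y) n
      = (-1) ^ (m + n) * q ^ (m * (m - 1) / 2 + n * (n - 1) / 2) * x ^ (m + n) * y ^ (m - n) := by
  unfold thetaTerm
  rw [zpow_add₀ (by norm_num), zpow_add₀ h0, zpow_add₀ hx, zpow_sub₀ hy, mul_zpow, div_zpow]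
  ring

/-- The even part `∑ q^{l²} y^{2l}` of a theta series in base `q^{1/2}`. -/
noncomputable def thetaEven (q y : ℂ) : ℂ := ∑' l : ℤ, q ^ (l * l) * y ^ (2 * l)

/-- The odd part `∑ q^{l²+l} y^{2l+1}`, up to a power of `q`, of a theta series in base
`q^{1/2}`. -/
noncomputable def thetaOdd (q y : ℂ) : ℂ := ∑' l : ℤ, q ^ (l * l + l) * y ^ (2 * l + 1)

/-- Up to sign these are the terms of `theta (q ^ 2) (q * y ^ 2)`. -/
theorem summable_thetaEven {q y : ℂ} (hq : ‖q‖ < 1) (h0 : q ≠ 0) (hy : y ≠ 0) :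
    Summable fun l : ℤ => ‖q ^ (l * l) * y ^ (2 * l)‖ := by
  have hq2 : ‖q ^ 2‖ < 1 := by
    rw [norm_pow]; exact pow_lt_one₀ (norm_nonneg q) hq (by norm_num)
  refine (summable_norm_thetaTerm hq2 (pow_ne_zero 2 h0)
    (mul_ne_zero h0 (pow_ne_zero 2 hy))).congr fun l => ?_
  have h := two_mul_choose l
  unfold thetaTerm
  rw [mul_zpow, ← zpow_natCast, ← zpow_natCast, ← zpow_mul, ← zpow_mul, Nat.cast_ofNat, h,
    mul_assoc, ← mul_assoc (q ^ _), ← zpow_add₀ h0, show l * (l - 1) + l = l * l by ring]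
  simp

theorem summable_thetaOdd {q y : ℂ} (hq : ‖q‖ < 1) (h0 : q ≠ 0) (hy : y ≠ 0) :
    Summable fun l : ℤ => ‖q ^ (l * l + l) * y ^ (2 * l + 1)‖ := by
  have hq2 : ‖q ^ 2‖ < 1 := by
    rw [norm_pow]; exact pow_lt_one₀ (norm_nonneg q) hq (by norm_num)
  refine ((summable_norm_thetaTerm hq2 (pow_ne_zero 2 h0)
    (pow_ne_zero 2 (mul_ne_zero h0 hy))).mul_right ‖y‖).congr fun l => ?_
  have h := two_mul_choose l
  unfold thetaTerm
  rw [mul_pow, mul_zpow, ← zpow_natCast, ← zpow_natCast, ← zpow_mul, ← zpow_mul, ← zpow_mul,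
    Nat.cast_ofNat, h, mul_assoc, ← mul_assoc (q ^ _), ← zpow_add₀ h0, zpow_add_one₀ hy,
    show l * (l - 1) + 2 * l = l * l + l by ring]
  simp [mul_assoc]

/-- Pairs (m, n) are split by the parity of m + n. The shift by 1 in the even class makes the total
exponent of q there (k² + k) + l², matching `thetaOdd` times `thetaEven`. -/
theorem isCompl_range_parity :
    IsCompl (Set.range fun p : ℤ × ℤ => (p.1 + 1 + p.2, p.1 + 1 - p.2))
      (Set.range fun p : ℤ × ℤ => (p.1 + p.2 + 1, p.1 - p.2)) := by
  refine isCompl_iff.2 ⟨Set.disjoint_left.2 ?_, codisjoint_iff.2 (Set.eq_univ_of_forall ?_)⟩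
  · rintro _ ⟨⟨a, b⟩, rfl⟩ ⟨⟨c, d⟩, h⟩
    simp only [Prod.mk.injEq] at h
    omega
  · rintro ⟨m, n⟩
    rcases Int.even_or_odd (m + n) with ⟨k, hk⟩ | ⟨k, hk⟩
    · exact Or.inl ⟨(k - 1, m - k), by simp only [Prod.mk.injEq]; omega⟩
    · exact Or.inr ⟨(k, m - k - 1), by simp only [Prod.mk.injEq]; omega⟩

/-- In the double series x carries the exponent m + n and y the exponent m - n, so on each parity
class the sum separates. The sign (-1)^(m+n) gives the odd class its minus sign. -/
theorem theta_mul_theta {q x y : ℂ} (hq : ‖q‖ < 1) (h0 : q ≠ 0) (hx : x ≠ 0) (hy : y ≠ 0) :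
    theta q (x * y) * theta q (x / y)
      = x * (thetaOdd q x * thetaEven q y - thetaEven q x * thetaOdd q y) := by
  have h1 := summable_norm_thetaTerm hq h0 (mul_ne_zero hx hy)
  have h2 := summable_norm_thetaTerm hq h0 (div_ne_zero hx hy)
  have hF := (summable_mul_of_summable_norm h1 h2).hasSum
  rw [← tsum_mul_tsum_of_summable_norm h1 h2] at hF
  have hA : HasSum (fun p : ℤ × ℤ => x * ((q ^ (p.1 * p.1 + p.1) * x ^ (2 * p.1 + 1))
      * (q ^ (p.2 * p.2) * y ^ (2 * p.2)))) (x * (thetaOdd q x * thetaEven q y)) := by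
    have h3 := summable_thetaOdd hq h0 hx
    have h4 := summable_thetaEven hq h0 hy
    have h5 := (summable_mul_of_summable_norm h3 h4).hasSum.mul_left x
    rwa [← tsum_mul_tsum_of_summable_norm h3 h4] at h5
  have hB : HasSum (fun p : ℤ × ℤ => -x * ((q ^ (p.1 * p.1) * x ^ (2 * p.1))
      * (q ^ (p.2 * p.2 + p.2) * y ^ (2 * p.2 + 1)))) (-x * (thetaEven q x * thetaOdd q y)) := by
    have h3 := summable_thetaEven hq h0 hx
    have h4 := summable_thetaOdd hq h0 hy
    have h5 := (summable_mul_of_summable_norm h3 h4).hasSum.mul_left (-x)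
    rwa [← tsum_mul_tsum_of_summable_norm h3 h4] at h5
  have i1 : Function.Injective fun p : ℤ × ℤ => (p.1 + 1 + p.2, p.1 + 1 - p.2) := by
    rintro ⟨a, b⟩ ⟨c, d⟩ h
    simp only [Prod.mk.injEq] at h ⊢
    omega
  have i2 : Function.Injective fun p : ℤ × ℤ => (p.1 + p.2 + 1, p.1 - p.2) := by
    rintro ⟨a, b⟩ ⟨c, d⟩ h
    simp only [Prod.mk.injEq] at h ⊢
    omega
  set F : ℤ × ℤ → ℂ := fun p => thetaTerm q (x * y) p.1 * thetaTerm q (x / y) p.2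
  have hA' : HasSum (F ∘ fun p : ℤ × ℤ => (p.1 + 1 + p.2, p.1 + 1 - p.2))
      (x * (thetaOdd q x * thetaEven q y)) := by
    refine hA.congr_fun fun p => ?_
    obtain ⟨k, l⟩ := p
    simp only [F, Function.comp]
    have e1 := two_mul_choose (k + 1 + l)
    have e2 := two_mul_choose (k + 1 - l)
    rw [thetaTerm_mul_thetaTerm h0 hx hy, show k + 1 + l + (k + 1 - l) = 2 * (k + 1) by ring,
      show k + 1 + l - (k + 1 - l) = 2 * l by ring, (even_two_mul (k + 1)).neg_one_zpow,
      show (k + 1 + l) * (k + 1 + l - 1) / 2 + (k + 1 - l) * (k + 1 - l - 1) / 2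
        = (k * k + k) + l * l by linarith,
      zpow_add₀ h0 (k * k + k), show 2 * (k + 1) = (2 * k + 1) + 1 by ring, zpow_add_one₀ hx]
    ring
  have hB' : HasSum (F ∘ fun p : ℤ × ℤ => (p.1 + p.2 + 1, p.1 - p.2))
      (-x * (thetaEven q x * thetaOdd q y)) := by
    refine hB.congr_fun fun p => ?_
    obtain ⟨k, l⟩ := p
    simp only [F, Function.comp]
    have e1 := two_mul_choose (k + l + 1)
    have e2 := two_mul_choose (k - l)
    rw [thetaTerm_mul_thetaTerm h0 hx hy, show k + l + 1 + (k - l) = 2 * k + 1 by ring,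
      show k + l + 1 - (k - l) = 2 * l + 1 by ring, (odd_two_mul_add_one k).neg_one_zpow,
      show (k + l + 1) * (k + l + 1 - 1) / 2 + (k - l) * (k - l - 1) / 2
        = k * k + (l * l + l) by linarith,
      zpow_add₀ h0 (k * k), zpow_add_one₀ hx]
    ring
  have h := HasSum.add_isCompl isCompl_range_parity (i1.hasSum_range_iff.2 hA')
    (i2.hasSum_range_iff.2 hB')
  rw [theta, theta, hF.unique h]
  ring

/-- The three-term relation of Weierstrass. -/
theorem theta_three_term {q x y u v : ℂ} (hq : ‖q‖ < 1) (h0 : q ≠ 0) (hx : x ≠ 0) (hy : y ≠ 0)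
    (hu : u ≠ 0) (hv : v ≠ 0) :
    y * (theta q (x * y) * theta q (x / y)) * (theta q (u * v) * theta q (u / v))
      = u * ((theta q (x * u) * theta q (x / u)) * (theta q (y * v) * theta q (y / v))
        - (theta q (x * v) * theta q (x / v)) * (theta q (y * u) * theta q (y / u))) := by
  -- Every product becomes a 2×2 minor of the vectors (`thetaOdd`, `thetaEven`) at x, y, u, v; the
  -- claim is the Plücker relation among them.
  rw [theta_mul_theta hq h0 hx hy, theta_mul_theta hq h0 hu hv, theta_mul_theta hq h0 hx hu,
    theta_mul_theta hq h0 hy hv, theta_mul_theta hq h0 hx hv, theta_mul_theta hq h0 hy hu]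
  ring

/-! ### Pair products, dissection, and the Rogers–Ramanujan identities -/

/-- The product `(z;q)_∞ (q/z;q)_∞`. -/
noncomputable def qPair (z q : ℂ) : ℂ := qPochInf z q * qPochInf (q / z) q

theorem theta_eq_mul_qPair {q z : ℂ} (hq : ‖q‖ < 1) (h0 : q ≠ 0) (hz : z ≠ 0) :
    theta q z = qPochInf q q * qPair z q := by
  rw [theta_eq_prod hq h0 hz, qPair, mul_assoc]

theorem qPair_three_term {q x y u v : ℂ} (hq : ‖q‖ < 1) (h0 : q ≠ 0) (hx : x ≠ 0) (hy : y ≠ 0)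
    (hu : u ≠ 0) (hv : v ≠ 0) :
    y * (qPair (x * y) q * qPair (x / y) q) * (qPair (u * v) q * qPair (u / v) q)
      = u * ((qPair (x * u) q * qPair (x / u) q) * (qPair (y * v) q * qPair (y / v) q)
        - (qPair (x * v) q * qPair (x / v) q) * (qPair (y * u) q * qPair (y / u) q)) := by
  have h := theta_three_term hq h0 hx hy hu hv
  have hm : ∀ {a b : ℂ}, a ≠ 0 → b ≠ 0 → theta q (a * b) = qPochInf q q * qPair (a * b) q :=
    fun ha hb => theta_eq_mul_qPair hq h0 (mul_ne_zero ha hb)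
  have hd : ∀ {a b : ℂ}, a ≠ 0 → b ≠ 0 → theta q (a / b) = qPochInf q q * qPair (a / b) q :=
    fun ha hb => theta_eq_mul_qPair hq h0 (div_ne_zero ha hb)
  rw [hm hx hy, hd hx hy, hm hu hv, hd hu hv, hm hx hu, hd hx hu, hm hy hv, hd hy hv, hm hx hv,
    hd hx hv, hm hy hu, hd hy hu] at h
  refine mul_left_cancel₀ (pow_ne_zero 4 (qPochInf_ne_zero hq)) ?_
  linear_combination h

theorem qPair_mul_base {q z : ℂ} (hq : ‖q‖ < 1) (h0 : q ≠ 0) (hz : z ≠ 0) :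
    z * qPair (q * z) q = -qPair z q := by
  have h := theta_mul_base h0 hz
  rw [theta_eq_mul_qPair hq h0 hz, theta_eq_mul_qPair hq h0 (mul_ne_zero h0 hz)] at h
  refine mul_left_cancel₀ (qPochInf_ne_zero hq) ?_
  linear_combination h

theorem qPair_div {q z : ℂ} (h0 : q ≠ 0) : qPair (q / z) q = qPair z q := by
  rw [qPair, qPair, div_div_cancel₀ h0, mul_comm]

theorem norm_pow_lt_one {q : ℂ} (hq : ‖q‖ < 1) {m : ℕ} (hm : m ≠ 0) : ‖q ^ m‖ < 1 := by
  rw [norm_pow]; exact pow_lt_one₀ (norm_nonneg q) hq hm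

theorem qPoch_mul (a q : ℂ) (m n : ℕ) :
    qPoch a q (m * n) = ∏ i ∈ Finset.range m, qPoch (a * q ^ i) (q ^ m) n := by
  induction n with
  | zero => simp [qPoch_zero]
  | succ n ih =>
    simp_rw [qPoch_succ]
    rw [Finset.prod_mul_distrib, ← ih, mul_add_one, qPoch, Finset.prod_range_add]
    congr 1
    refine Finset.prod_congr rfl fun i _ => ?_
    rw [← pow_mul, pow_add]
    ring

theorem qPochInf_eq_prod (a : ℂ) {q : ℂ} (hq : ‖q‖ < 1) {m : ℕ} (hm : m ≠ 0) :
    qPochInf a q = ∏ i ∈ Finset.range m, qPochInf (a * q ^ i) (q ^ m) := by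
  have h1 : Tendsto (fun n => qPoch a q (m * n)) atTop (𝓝 (qPochInf a q)) :=
    (tendsto_qPoch a hq).comp (tendsto_id.const_mul_atTop' (Nat.pos_of_ne_zero hm))
  refine tendsto_nhds_unique h1 ?_
  simp_rw [qPoch_mul]
  exact tendsto_finsetProd _ fun i _ => tendsto_qPoch _ (norm_pow_lt_one hq hm)

theorem qPair_eq_prod {z q : ℂ} (hq : ‖q‖ < 1) (h0 : q ≠ 0) {m : ℕ} (hm : m ≠ 0) :
    qPair z q = ∏ i ∈ Finset.range m, qPair (z * q ^ i) (q ^ m) := by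
  simp_rw [qPair]
  rw [Finset.prod_mul_distrib, ← qPochInf_eq_prod z hq hm, qPochInf_eq_prod (q / z) hq hm,
    -- The reflection i ↦ m-1-i is needed because q^m/(z q^i) = (q/z) q^(m-1-i).
    ← Finset.prod_range_reflect (fun i => qPochInf (q ^ m / (z * q ^ i)) (q ^ m))]
  congr 1
  refine Finset.prod_congr rfl fun i hi => ?_
  rw [Finset.mem_range] at hi
  congr 1
  have h : q ^ m = q * q ^ i * q ^ (m - 1 - i) := by
    rw [← pow_succ', ← pow_add]; congr 1; omega
  have := pow_ne_zero (m - 1 - i) h0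
  rw [h, mul_div_mul_right _ _ this, div_mul_eq_mul_div]

theorem qPochInf_sq (a : ℂ) {q : ℂ} (hq : ‖q‖ < 1) :
    qPochInf (a ^ 2) (q ^ 2) = qPochInf a q * qPochInf (-a) q := by
  refine tendsto_nhds_unique (tendsto_qPoch _ (norm_pow_lt_one hq two_ne_zero)) ?_
  refine ((tendsto_qPoch a hq).mul (tendsto_qPoch (-a) hq)).congr fun n => ?_
  simp_rw [qPoch]
  rw [← Finset.prod_mul_distrib]
  refine Finset.prod_congr rfl fun i _ => ?_
  ring

theorem qPair_sq (z : ℂ) {q : ℂ} (hq : ‖q‖ < 1) :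
    qPair (z ^ 2) (q ^ 2) = qPair z q * qPair (-z) q := by
  simp_rw [qPair]
  rw [← div_pow, qPochInf_sq _ hq, qPochInf_sq _ hq, div_neg]
  ring

theorem qPochInf_ne_zero_of_norm_lt_one {a q : ℂ} (ha : ‖a‖ < 1) (hq : ‖q‖ < 1) :
    qPochInf a q ≠ 0 := by
  have h := tprod_one_add_ne_zero_of_summable (f := fun k : ℕ => -(a * q ^ k)) (fun k h => ?_)
    (summable_neg_mul_pow a hq)
  · simpa only [qPochInf, sub_eq_add_neg] using h
  · have h1 : a * q ^ k = 1 := by linear_combination -h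
    have h2 : ‖a‖ * ‖q‖ ^ k = 1 := by rw [← norm_pow, ← norm_mul, h1, norm_one]
    have h3 := mul_le_of_le_one_right (norm_nonneg a) (pow_le_one₀ (norm_nonneg q) hq.le (n := k))
    linarith

theorem qPair_ne_zero {z q : ℂ} (hq : ‖q‖ < 1) (hz : ‖z‖ < 1) (hqz : ‖q / z‖ < 1) :
    qPair z q ≠ 0 :=
  mul_ne_zero (qPochInf_ne_zero_of_norm_lt_one hz hq) (qPochInf_ne_zero_of_norm_lt_one hqz hq)

theorem qPochInf_self_eq_mul {q : ℂ} (hq : ‖q‖ < 1) (h0 : q ≠ 0) :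
    qPochInf q q = qPair q (q ^ 5) * qPair (q ^ 2) (q ^ 5) * qPochInf (q ^ 5) (q ^ 5) := by
  rw [qPochInf_eq_prod q hq (m := 5) (by norm_num)]
  have h1 : q ^ 5 / q = q ^ 4 := by field_simp
  have h2 : q ^ 5 / q ^ 2 = q ^ 3 := by field_simp
  simp only [Finset.prod_range_succ, Finset.prod_range_zero, ← pow_succ', qPair, h1, h2]
  norm_num only
  ring_nf

/-- The first Rogers–Ramanujan identity. -/
theorem G_mul_qPair {q : ℂ} (hq : ‖q‖ < 1) (h0 : q ≠ 0) : G q * qPair q (q ^ 5) = 1 := by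
  have h5 := norm_pow_lt_one hq (m := 5) (by norm_num)
  have h := qPochInf_mul_G hq h0
  have hP := qPochInf_ne_zero hq
  rw [theta_eq_mul_qPair h5 (pow_ne_zero 5 h0) (pow_ne_zero 2 h0)] at h
  refine mul_left_cancel₀ hP ?_
  linear_combination qPair q (q ^ 5) * h - qPochInf_self_eq_mul hq h0

/-- The second Rogers–Ramanujan identity. -/
theorem H_mul_qPair {q : ℂ} (hq : ‖q‖ < 1) (h0 : q ≠ 0) : H q * qPair (q ^ 2) (q ^ 5) = 1 := by
  have h5 := norm_pow_lt_one hq (m := 5) (by norm_num)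
  have h := qPochInf_mul_H hq h0
  have hP := qPochInf_ne_zero hq
  rw [theta_eq_mul_qPair h5 (pow_ne_zero 5 h0) (pow_ne_zero 4 h0)] at h
  have h4 : qPair (q ^ 4) (q ^ 5) = qPair q (q ^ 5) := by
    rw [← qPair_div (z := q) (pow_ne_zero 5 h0)]
    congr 1
    field_simp
  rw [h4] at h
  refine mul_left_cancel₀ hP ?_
  linear_combination qPair (q ^ 2) (q ^ 5) * h - qPochInf_self_eq_mul hq h0


/-! ### Pair products at powers of q -/

theorem qPair_pow_reflect {q : ℂ} (h0 : q ≠ 0) {a b n : ℕ} (h : a + b = n) :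
    qPair (q ^ b) (q ^ n) = qPair (q ^ a) (q ^ n) := by
  rw [← qPair_div (z := q ^ a) (pow_ne_zero n h0), ← h, pow_add,
    mul_div_cancel_left₀ _ (pow_ne_zero a h0)]

theorem qPair_neg_pow_reflect {q : ℂ} (h0 : q ≠ 0) {a b n : ℕ} (h : a + b = n) :
    qPair (-q ^ b) (q ^ n) = qPair (-q ^ a) (q ^ n) := by
  rw [← qPair_div (z := -q ^ a) (pow_ne_zero n h0), ← h, pow_add, div_neg,
    mul_div_cancel_left₀ _ (pow_ne_zero a h0)]

theorem qPair_pow_eq_prod {q : ℂ} (hq : ‖q‖ < 1) (h0 : q ≠ 0) (a n m : ℕ) {N : ℕ} (hn : n ≠ 0)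
    (hm : m ≠ 0) (h : n * m = N) :
    qPair (q ^ a) (q ^ n) = ∏ i ∈ Finset.range m, qPair (q ^ (a + n * i)) (q ^ N) := by
  rw [qPair_eq_prod (norm_pow_lt_one hq hn) (pow_ne_zero n h0) hm]
  simp_rw [← pow_mul, ← pow_add, h]

theorem qPair_neg_pow_eq_prod {q : ℂ} (hq : ‖q‖ < 1) (h0 : q ≠ 0) (a n m : ℕ) {N : ℕ} (hn : n ≠ 0)
    (hm : m ≠ 0) (h : n * m = N) :
    qPair (-q ^ a) (q ^ n) = ∏ i ∈ Finset.range m, qPair (-q ^ (a + n * i)) (q ^ N) := by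
  rw [qPair_eq_prod (norm_pow_lt_one hq hn) (pow_ne_zero n h0) hm]
  simp_rw [neg_mul, ← pow_mul, ← pow_add, h]

theorem qPair_pow_ne_zero {q : ℂ} (hq : ‖q‖ < 1) (h0 : q ≠ 0) {a n : ℕ} (ha : a ≠ 0) (han : a < n) :
    qPair (q ^ a) (q ^ n) ≠ 0 := by
  refine qPair_ne_zero (norm_pow_lt_one hq (by omega)) (norm_pow_lt_one hq ha) ?_
  rw [div_eq_mul_inv, ← pow_sub₀ _ h0 han.le]
  exact norm_pow_lt_one hq (by omega)

theorem qPair_neg_pow_ne_zero {q : ℂ} (hq : ‖q‖ < 1) (h0 : q ≠ 0) {a n : ℕ} (ha : a ≠ 0)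
    (han : a < n) : qPair (-q ^ a) (q ^ n) ≠ 0 := by
  refine qPair_ne_zero (norm_pow_lt_one hq (by omega)) ?_ ?_
  · rw [norm_neg]; exact norm_pow_lt_one hq ha
  · rw [div_neg, norm_neg, div_eq_mul_inv, ← pow_sub₀ _ h0 han.le]
    exact norm_pow_lt_one hq (by omega)

theorem qPochInf_self_mul_self {q : ℂ} (hq : ‖q‖ < 1) (h0 : q ≠ 0) :
    qPochInf q q * qPochInf (q ^ 6) (q ^ 6)
      = qPair q (q ^ 6) * (qPochInf (q ^ 2) (q ^ 2) * qPochInf (q ^ 3) (q ^ 3)) := by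
  rw [qPochInf_eq_prod q hq (m := 6) (by norm_num),
    qPochInf_eq_prod (q ^ 2) (norm_pow_lt_one hq two_ne_zero) (m := 3) (by norm_num),
    qPochInf_eq_prod (q ^ 3) (norm_pow_lt_one hq three_ne_zero) (m := 2) (by norm_num)]
  have h1 : q ^ 6 / q = q ^ 5 := by field_simp
  simp only [Finset.prod_range_succ, Finset.prod_range_zero, ← pow_succ', ← pow_mul, ← pow_add,
    qPair, h1]
  norm_num only
  ring_nf

/-- Both [q;q^3] [-q;q^3] and [q;q^3] = [q;q^6] [q^4;q^6] are computed, the former being [q^2;q^6] =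
[q^4;q^6]; the common factor cancels. -/
theorem qPair_mul_qPair_neg {q : ℂ} (hq : ‖q‖ < 1) (h0 : q ≠ 0) :
    qPair q (q ^ 6) * qPair (-q) (q ^ 3) = 1 := by
  have h1 := qPair_sq q (norm_pow_lt_one hq three_ne_zero)
  have h2 := qPair_pow_eq_prod hq h0 1 3 2 (by norm_num) (by norm_num) rfl
  have h3 := qPair_pow_reflect h0 (show 2 + 4 = 6 by norm_num)
  have h4 := qPair_pow_ne_zero hq h0 two_ne_zero (show 2 < 6 by norm_num)
  rw [← pow_mul] at h1
  simp only [Finset.prod_range_succ, Finset.prod_range_zero, pow_one] at h2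
  norm_num only at h1 h2
  rw [pow_one, h3] at h2
  rw [h2] at h1
  refine mul_left_cancel₀ h4 ?_
  linear_combination -h1

/-! ### The two instances of the three-term relation -/

theorem qPair_relation_thirty {q : ℂ} (hq : ‖q‖ < 1) (h0 : q ≠ 0) :
    qPair (q ^ 6) (q ^ 30) ^ 2 * qPair (q ^ 7) (q ^ 30) * qPair (q ^ 13) (q ^ 30)
        - qPair (q ^ 1) (q ^ 30) * qPair (q ^ 11) (q ^ 30) * qPair (q ^ 12) (q ^ 30) ^ 2
      = q * qPair (q ^ 5) (q ^ 30) ^ 2 * qPair (q ^ 6) (q ^ 30) * qPair (q ^ 12) (q ^ 30) := by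
  -- The parameters are the half-integral powers q^(43/2), q^(29/2), q^(19/2), q^(7/2), hence the
  -- square root. Their products and quotients are integral powers of q.
  obtain ⟨t, rfl⟩ : ∃ t, t ^ 2 = q := IsAlgClosed.exists_pow_nat_eq q two_pos
  have ht : t ≠ 0 := by rintro rfl; simp at h0
  have h := qPair_three_term (norm_pow_lt_one hq (m := 30) (by norm_num)) (pow_ne_zero 30 h0)
    (pow_ne_zero 43 ht) (pow_ne_zero 29 ht) (pow_ne_zero 19 ht) (pow_ne_zero 7 ht)
  have s1 := qPair_mul_base (norm_pow_lt_one hq (m := 30) (by norm_num)) (pow_ne_zero 30 h0)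
    (pow_ne_zero 6 h0)
  have s2 := qPair_mul_base (norm_pow_lt_one hq (m := 30) (by norm_num)) (pow_ne_zero 30 h0)
    (pow_ne_zero 1 h0)
  have r1 := qPair_pow_reflect h0 (show 12 + 18 = 30 by norm_num)
  have r2 := qPair_pow_reflect h0 (show 6 + 24 = 30 by norm_num)
  have r3 := qPair_pow_reflect h0 (show 5 + 25 = 30 by norm_num)
  have e1 : t ^ 43 / t ^ 29 = (t ^ 2) ^ 7 := by field_simp
  have e2 : t ^ 19 / t ^ 7 = (t ^ 2) ^ 6 := by field_simp
  have e3 : t ^ 43 / t ^ 19 = (t ^ 2) ^ 12 := by field_simp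
  have e4 : t ^ 29 / t ^ 7 = (t ^ 2) ^ 11 := by field_simp
  have e5 : t ^ 43 / t ^ 7 = (t ^ 2) ^ 18 := by field_simp
  have e6 : t ^ 29 / t ^ 19 = (t ^ 2) ^ 5 := by field_simp
  have f1 : t ^ 43 * t ^ 29 = (t ^ 2) ^ 30 * (t ^ 2) ^ 6 := by ring
  have f2 : t ^ 19 * t ^ 7 = (t ^ 2) ^ 13 := by ring
  have f3 : t ^ 43 * t ^ 19 = (t ^ 2) ^ 30 * (t ^ 2) ^ 1 := by ring
  have f4 : t ^ 29 * t ^ 7 = (t ^ 2) ^ 18 := by ring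
  have f5 : t ^ 43 * t ^ 7 = (t ^ 2) ^ 25 := by ring
  have f6 : t ^ 29 * t ^ 19 = (t ^ 2) ^ 24 := by ring
  rw [e1, e2, e3, e4, e5, e6, f1, f2, f3, f4, f5, f6, r1, r2, r3] at h
  set X := qPair ((t ^ 2) ^ 30 * (t ^ 2) ^ 6) ((t ^ 2) ^ 30)
  set Y := qPair ((t ^ 2) ^ 30 * (t ^ 2) ^ 1) ((t ^ 2) ^ 30)
  set C6 := qPair ((t ^ 2) ^ 6) ((t ^ 2) ^ 30)
  set C1 := qPair ((t ^ 2) ^ 1) ((t ^ 2) ^ 30)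
  -- Reducing q^36 and q^31 modulo q^30 costs -q^(-6) and -q^(-1), which leaves t^17 common to all
  -- three terms.
  refine mul_left_cancel₀ (pow_ne_zero 17 ht) ?_
  generalize qPair ((t ^ 2) ^ 7) ((t ^ 2) ^ 30) = C7 at *
  generalize qPair ((t ^ 2) ^ 13) ((t ^ 2) ^ 30) = C13 at *
  generalize qPair ((t ^ 2) ^ 12) ((t ^ 2) ^ 30) = C12 at *
  generalize qPair ((t ^ 2) ^ 11) ((t ^ 2) ^ 30) = C11 at *
  generalize qPair ((t ^ 2) ^ 5) ((t ^ 2) ^ 30) = C5 at *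
  linear_combination (-1) * h + t ^ 17 * C6 * C7 * C13 * s1 - t ^ 17 * C12 ^ 2 * C11 * s2

theorem qPair_relation_fifteen {q : ℂ} (hq : ‖q‖ < 1) (h0 : q ≠ 0) :
    qPair (q ^ 6) (q ^ 15) ^ 2 * qPair (-q ^ 2) (q ^ 15) * qPair (-q ^ 7) (q ^ 15)
        - q ^ 2 * qPair (-q ^ 1) (q ^ 15) * qPair (-q ^ 4) (q ^ 15) * qPair (q ^ 3) (q ^ 15) ^ 2
      = qPair (-q ^ 5) (q ^ 15) ^ 2 * qPair (q ^ 3) (q ^ 15) * qPair (q ^ 6) (q ^ 15) := by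
  have hI := Complex.I_ne_zero
  have hI2 := Complex.I_sq
  have h15 := norm_pow_lt_one hq (m := 15) (by norm_num)
  -- The factors ±i make each product and its matching quotient differ in sign, so that arguments
  -- q^a and -q^b both occur, as the second identity requires.
  have h := qPair_three_term h15 (pow_ne_zero 15 h0)
    (mul_ne_zero hI (pow_ne_zero 14 h0)) (neg_ne_zero.2 (mul_ne_zero hI (pow_ne_zero 7 h0)))
    (neg_ne_zero.2 (mul_ne_zero hI (pow_ne_zero 4 h0))) (mul_ne_zero hI (pow_ne_zero 2 h0))
  have s1 := qPair_mul_base h15 (pow_ne_zero 15 h0) (pow_ne_zero 6 h0)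
  have s2 := qPair_mul_base h15 (pow_ne_zero 15 h0) (pow_ne_zero 3 h0)
  have s3 := qPair_mul_base h15 (pow_ne_zero 15 h0) (neg_ne_zero.2 (pow_ne_zero 1 h0))
  have r1 := qPair_pow_reflect h0 (show 6 + 9 = 15 by norm_num)
  have r2 := qPair_pow_reflect h0 (show 3 + 12 = 15 by norm_num)
  have r3 := qPair_neg_pow_reflect h0 (show 5 + 10 = 15 by norm_num)
  have r4 := qPair_neg_pow_reflect h0 (show 4 + 11 = 15 by norm_num)
  have f1 : Complex.I * q ^ 14 * -(Complex.I * q ^ 7) = q ^ 15 * q ^ 6 := by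
    linear_combination -q ^ 21 * hI2
  have f2 : -(Complex.I * q ^ 4) * (Complex.I * q ^ 2) = q ^ 6 := by
    linear_combination -q ^ 6 * hI2
  have f3 : Complex.I * q ^ 14 * -(Complex.I * q ^ 4) = q ^ 15 * q ^ 3 := by
    linear_combination -q ^ 18 * hI2
  have f4 : -(Complex.I * q ^ 7) * (Complex.I * q ^ 2) = q ^ 9 := by
    linear_combination -q ^ 9 * hI2
  have f5 : Complex.I * q ^ 14 * (Complex.I * q ^ 2) = q ^ 15 * -q ^ 1 := by
    linear_combination q ^ 16 * hI2
  have f6 : -(Complex.I * q ^ 7) * -(Complex.I * q ^ 4) = -q ^ 11 := by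
    linear_combination q ^ 11 * hI2
  have e1 : Complex.I * q ^ 14 / -(Complex.I * q ^ 7) = -q ^ 7 := by field_simp
  have e2 : -(Complex.I * q ^ 4) / (Complex.I * q ^ 2) = -q ^ 2 := by field_simp
  have e3 : Complex.I * q ^ 14 / -(Complex.I * q ^ 4) = -q ^ 10 := by field_simp
  have e4 : -(Complex.I * q ^ 7) / (Complex.I * q ^ 2) = -q ^ 5 := by field_simp
  have e5 : Complex.I * q ^ 14 / (Complex.I * q ^ 2) = q ^ 12 := by field_simp
  have e6 : -(Complex.I * q ^ 7) / -(Complex.I * q ^ 4) = q ^ 3 := by field_simp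
  rw [e1, e2, e3, e4, e5, e6, f1, f2, f3, f4, f5, f6, r1, r2, r3, r4] at h
  generalize qPair (q ^ 15 * q ^ 6) (q ^ 15) = X at *
  generalize qPair (q ^ 15 * q ^ 3) (q ^ 15) = Y at *
  generalize qPair (q ^ 15 * -q ^ 1) (q ^ 15) = Z at *
  generalize qPair (q ^ 6) (q ^ 15) = E6 at *
  generalize qPair (q ^ 3) (q ^ 15) = E3 at *
  generalize qPair (-q ^ 1) (q ^ 15) = D1 at *
  generalize qPair (-q ^ 4) (q ^ 15) = D4 at *
  generalize qPair (-q ^ 5) (q ^ 15) = D5 at *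
  generalize qPair (-q ^ 2) (q ^ 15) = D2 at *
  generalize qPair (-q ^ 7) (q ^ 15) = D7 at *
  refine mul_left_cancel₀ (mul_ne_zero hI h0) ?_
  linear_combination h + Complex.I * q * E6 * D2 * D7 * s1 - Complex.I * q * E6 * D5 ^ 2 * s2
    - Complex.I * q ^ 3 * E3 ^ 2 * D4 * s3

/-! ### Reduction of the two identities to the pair-product relations -/

theorem G_eq_inv {q : ℂ} (hq : ‖q‖ < 1) (h0 : q ≠ 0) {m : ℕ} (hm : m ≠ 0) :
    G (q ^ m) = (qPair (q ^ m) (q ^ (5 * m)))⁻¹ := by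
  have h := G_mul_qPair (norm_pow_lt_one hq hm) (pow_ne_zero m h0)
  rw [← pow_mul, mul_comm m] at h
  exact eq_inv_of_mul_eq_one_left h

theorem H_eq_inv {q : ℂ} (hq : ‖q‖ < 1) (h0 : q ≠ 0) {m : ℕ} (hm : m ≠ 0) :
    H (q ^ m) = (qPair (q ^ (2 * m)) (q ^ (5 * m)))⁻¹ := by
  have h := H_mul_qPair (norm_pow_lt_one hq hm) (pow_ne_zero m h0)
  rw [← pow_mul, ← pow_mul, mul_comm m, mul_comm m] at h
  exact eq_inv_of_mul_eq_one_left h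

theorem G_zero : G 0 = 1 := by
  rw [G, tsum_eq_single 0]
  · simp [qPoch_zero]
  · intro n hn
    simp [hn]

theorem H_zero : H 0 = 1 := by
  rw [H, tsum_eq_single 0]
  · simp [qPoch_zero]
  · intro n hn
    simp [hn]

theorem qPochInf_zero_left (q : ℂ) : qPochInf 0 q = 1 := by simp [qPochInf]

theorem G_sub_H_identity {q : ℂ} (hq : ‖q‖ < 1) (h0 : q ≠ 0) :
    G (q ^ 2) * G (q ^ 3) / (H (q ^ 1) * G (q ^ 6))
        - H (q ^ 2) * H (q ^ 3) / (G (q ^ 1) * H (q ^ 6))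
      = q * qPair (q ^ 5) (q ^ 30) ^ 2 := by
  have h := qPair_relation_thirty hq h0
  have hne : ∀ a : ℕ, a ≠ 0 ∧ a < 30 → qPair (q ^ a) (q ^ 30) ≠ 0 :=
    fun a ha => qPair_pow_ne_zero hq h0 ha.1 ha.2
  rw [G_eq_inv hq h0 one_ne_zero, G_eq_inv hq h0 two_ne_zero, G_eq_inv hq h0 three_ne_zero,
    G_eq_inv hq h0 (m := 6) (by norm_num), H_eq_inv hq h0 one_ne_zero, H_eq_inv hq h0 two_ne_zero,
    H_eq_inv hq h0 three_ne_zero, H_eq_inv hq h0 (m := 6) (by norm_num),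
    qPair_pow_eq_prod hq h0 1 (5 * 1) 6 (N := 30) (by norm_num) (by norm_num) (by norm_num),
    qPair_pow_eq_prod hq h0 (2 * 1) (5 * 1) 6 (N := 30) (by norm_num) (by norm_num) (by norm_num),
    qPair_pow_eq_prod hq h0 2 (5 * 2) 3 (N := 30) (by norm_num) (by norm_num) (by norm_num),
    qPair_pow_eq_prod hq h0 (2 * 2) (5 * 2) 3 (N := 30) (by norm_num) (by norm_num) (by norm_num),
    qPair_pow_eq_prod hq h0 3 (5 * 3) 2 (N := 30) (by norm_num) (by norm_num) (by norm_num),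
    qPair_pow_eq_prod hq h0 (2 * 3) (5 * 3) 2 (N := 30) (by norm_num) (by norm_num) (by norm_num)]
  simp only [Finset.prod_range_succ, Finset.prod_range_zero]
  norm_num only
  rw [qPair_pow_reflect h0 (show 14 + 16 = 30 by norm_num),
    qPair_pow_reflect h0 (show 9 + 21 = 30 by norm_num),
    qPair_pow_reflect h0 (show 4 + 26 = 30 by norm_num),
    qPair_pow_reflect h0 (show 13 + 17 = 30 by norm_num),
    qPair_pow_reflect h0 (show 8 + 22 = 30 by norm_num),
    qPair_pow_reflect h0 (show 3 + 27 = 30 by norm_num),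
    qPair_pow_reflect h0 (show 6 + 24 = 30 by norm_num),
    qPair_pow_reflect h0 (show 12 + 18 = 30 by norm_num)]
  have n1 := hne 1 (by norm_num)
  have n2 := hne 2 (by norm_num)
  have n3 := hne 3 (by norm_num)
  have n4 := hne 4 (by norm_num)
  have n6 := hne 6 (by norm_num)
  have n8 := hne 8 (by norm_num)
  have n9 := hne 9 (by norm_num)
  have n11 := hne 11 (by norm_num)
  have n12 := hne 12 (by norm_num)
  have n14 := hne 14 (by norm_num)
  generalize qPair (q ^ 1) (q ^ 30) = C1 at *
  generalize qPair (q ^ 2) (q ^ 30) = C2 at *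
  generalize qPair (q ^ 3) (q ^ 30) = C3 at *
  generalize qPair (q ^ 4) (q ^ 30) = C4 at *
  generalize qPair (q ^ 5) (q ^ 30) = C5 at *
  generalize qPair (q ^ 6) (q ^ 30) = C6 at *
  generalize qPair (q ^ 7) (q ^ 30) = C7 at *
  generalize qPair (q ^ 8) (q ^ 30) = C8 at *
  generalize qPair (q ^ 9) (q ^ 30) = C9 at *
  generalize qPair (q ^ 11) (q ^ 30) = C11 at *
  generalize qPair (q ^ 12) (q ^ 30) = C12 at *
  generalize qPair (q ^ 13) (q ^ 30) = C13 at *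
  generalize qPair (q ^ 14) (q ^ 30) = C14 at *
  -- After all cancellations the two quotients are C7 C13 C6 / C12 and C1 C11 C12 / C6; multiplying
  -- by C6 C12 recovers the base q^30 relation.
  have e : C7 * C13 * C6 / C12 - C1 * C11 * C12 / C6 = q * C5 ^ 2 := by
    field_simp
    linear_combination h
  rw [← e]
  congr 1 <;> field_simp

theorem H_sub_G_identity {q : ℂ} (hq : ‖q‖ < 1) (h0 : q ≠ 0) :
    H (q ^ 1) * G (q ^ 6) / (H (q ^ 2) * H (q ^ 3))
        - q ^ 2 * (G (q ^ 1) * H (q ^ 6) / (G (q ^ 2) * G (q ^ 3)))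
      = qPair (-q ^ 5) (q ^ 15) ^ 2 := by
  have h := qPair_relation_fifteen hq h0
  have hne : ∀ a : ℕ, a ≠ 0 ∧ a < 15 → qPair (q ^ a) (q ^ 15) ≠ 0 :=
    fun a ha => qPair_pow_ne_zero hq h0 ha.1 ha.2
  have hne' : ∀ a : ℕ, a ≠ 0 ∧ a < 15 → qPair (-q ^ a) (q ^ 15) ≠ 0 :=
    fun a ha => qPair_neg_pow_ne_zero hq h0 ha.1 ha.2
  -- Factors of base q^10 and q^30 are split by [z²;q²] = [z;q] [-z;q], so that everything can be
  -- dissected to base q^15.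
  have hsq : ∀ a n : ℕ, n ≠ 0 → qPair (q ^ (a * 2)) (q ^ (n * 2))
      = qPair (q ^ a) (q ^ n) * qPair (-q ^ a) (q ^ n) := fun a n hn => by
    rw [pow_mul, pow_mul, qPair_sq _ (norm_pow_lt_one hq hn)]
  have g2 := hsq 1 5 (by norm_num)
  have g6 := hsq 3 15 (by norm_num)
  have k2 := hsq 2 5 (by norm_num)
  have k6 := hsq 6 15 (by norm_num)
  norm_num only at g2 g6 k2 k6
  rw [G_eq_inv hq h0 one_ne_zero, G_eq_inv hq h0 two_ne_zero, G_eq_inv hq h0 three_ne_zero,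
    G_eq_inv hq h0 (m := 6) (by norm_num), H_eq_inv hq h0 one_ne_zero, H_eq_inv hq h0 two_ne_zero,
    H_eq_inv hq h0 three_ne_zero, H_eq_inv hq h0 (m := 6) (by norm_num)]
  norm_num only
  rw [g2, g6, k2, k6,
    qPair_pow_eq_prod hq h0 1 5 3 (N := 15) (by norm_num) (by norm_num) (by norm_num),
    qPair_pow_eq_prod hq h0 2 5 3 (N := 15) (by norm_num) (by norm_num) (by norm_num),
    qPair_neg_pow_eq_prod hq h0 1 5 3 (N := 15) (by norm_num) (by norm_num) (by norm_num),
    qPair_neg_pow_eq_prod hq h0 2 5 3 (N := 15) (by norm_num) (by norm_num) (by norm_num)]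
  simp only [Finset.prod_range_succ, Finset.prod_range_zero]
  norm_num only
  rw [qPair_pow_reflect h0 (show 4 + 11 = 15 by norm_num),
    qPair_pow_reflect h0 (show 3 + 12 = 15 by norm_num),
    qPair_neg_pow_reflect h0 (show 4 + 11 = 15 by norm_num),
    qPair_neg_pow_reflect h0 (show 3 + 12 = 15 by norm_num)]
  have n1 := hne 1 (by norm_num)
  have n2 := hne 2 (by norm_num)
  have n3 := hne 3 (by norm_num)
  have n4 := hne 4 (by norm_num)
  have n6 := hne 6 (by norm_num)
  have n7 := hne 7 (by norm_num)
  have m3 := hne' 3 (by norm_num)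
  have m6 := hne' 6 (by norm_num)
  generalize qPair (q ^ 1) (q ^ 15) = E1 at *
  generalize qPair (q ^ 2) (q ^ 15) = E2 at *
  generalize qPair (q ^ 3) (q ^ 15) = E3 at *
  generalize qPair (q ^ 4) (q ^ 15) = E4 at *
  generalize qPair (q ^ 6) (q ^ 15) = E6 at *
  generalize qPair (q ^ 7) (q ^ 15) = E7 at *
  generalize qPair (-q ^ 1) (q ^ 15) = D1 at *
  generalize qPair (-q ^ 2) (q ^ 15) = D2 at *
  generalize qPair (-q ^ 3) (q ^ 15) = D3 at *
  generalize qPair (-q ^ 4) (q ^ 15) = D4 at *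
  generalize qPair (-q ^ 5) (q ^ 15) = D5 at *
  generalize qPair (-q ^ 6) (q ^ 15) = D6 at *
  generalize qPair (-q ^ 7) (q ^ 15) = D7 at *
  have e : D2 * D7 * E6 / E3 - q ^ 2 * (D1 * D4 * E3 / E6) = D5 ^ 2 := by
    field_simp
    linear_combination h
  rw [← e]
  congr 1
  · field_simp
  · congr 1
    field_simp

theorem qPochInf_quotient {q : ℂ} (hq : ‖q‖ < 1) (h0 : q ≠ 0) :
    qPochInf (q ^ 5) (q ^ 5) * qPochInf (q ^ 30) (q ^ 30)
      = qPair (q ^ 5) (q ^ 30) * (qPochInf (q ^ 10) (q ^ 10) * qPochInf (q ^ 15) (q ^ 15)) := by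
  have h := qPochInf_self_mul_self (norm_pow_lt_one hq (m := 5) (by norm_num)) (pow_ne_zero 5 h0)
  simpa only [← pow_mul, Nat.reduceMul] using h

end RogersRamanujan

open RogersRamanujan in
theorem theorem1p3 (q : ℂ) (hq : ‖q‖ < 1) :
    (G q ≠ 0 ∧ H q ≠ 0) ∧
    G (q ^ 2) * G (q ^ 3) / (H q * G (q ^ 6)) - H (q ^ 2) * H (q ^ 3) / (G q * H (q ^ 6))
      = q * (qPochInf (q ^ 5) (q ^ 5) ^ 2 * qPochInf (q ^ 30) (q ^ 30) ^ 2
          / (qPochInf (q ^ 10) (q ^ 10) ^ 2 * qPochInf (q ^ 15) (q ^ 15) ^ 2)) ∧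
    H q * G (q ^ 6) / (H (q ^ 2) * H (q ^ 3))
        - q ^ 2 * (G q * H (q ^ 6) / (G (q ^ 2) * G (q ^ 3)))
      = qPochInf (q ^ 10) (q ^ 10) ^ 2 * qPochInf (q ^ 15) (q ^ 15) ^ 2
          / (qPochInf (q ^ 5) (q ^ 5) ^ 2 * qPochInf (q ^ 30) (q ^ 30) ^ 2) := by
  -- The theta series use negative powers of q, so q = 0 is checked directly: there G, H and all the
  -- infinite products equal 1.
  rcases eq_or_ne q 0 with rfl | h0
  · simp [G_zero, H_zero, qPochInf_zero_left]
  have hP : ∀ m : ℕ, m ≠ 0 → qPochInf (q ^ m) (q ^ m) ≠ 0 :=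
    fun m hm => qPochInf_ne_zero (norm_pow_lt_one hq hm)
  have h1 := G_sub_H_identity hq h0
  have h2 := H_sub_G_identity hq h0
  have h3 := qPochInf_quotient hq h0
  have h4 := qPair_mul_qPair_neg (norm_pow_lt_one hq (m := 5) (by norm_num)) (pow_ne_zero 5 h0)
  rw [← pow_mul, ← pow_mul] at h4
  norm_num only at h4
  rw [pow_one] at h1 h2
  have p10 := hP 10 (by norm_num)
  have p15 := hP 15 (by norm_num)
  have hC : qPair (q ^ 5) (q ^ 30) ≠ 0 := left_ne_zero_of_mul_eq_one h4
  refine ⟨⟨left_ne_zero_of_mul_eq_one (G_mul_qPair hq h0),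
    left_ne_zero_of_mul_eq_one (H_mul_qPair hq h0)⟩, ?_, ?_⟩
  · rw [h1, ← mul_pow, ← mul_pow, h3, mul_pow, mul_div_cancel_right₀]
    exact pow_ne_zero 2 (mul_ne_zero p10 p15)
  · rw [h2, ← mul_pow, ← mul_pow, h3, eq_inv_of_mul_eq_one_right h4]
    field_simp
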